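/- **Conventions.** All spaces are Tychonoff (completely regular Hausdorff); no separation axiom is needed for the group $G$. A *semitopological group* is a group $G$ with a topology for which the multiplication $G\times G\to G$ is separately continuous. It is *$\omega$-narrow* if for every neighborhood $U$ of the neutral element there is a countable $A\subset G$ with $UA=AU=G$. A *$G$-compactification* of a space $X$ with an action of $G$ is a Hausdorff compactification $\widetilde X$ of $X$ such that the action extends to a (jointly) continuous action $G\times\widetilde X\to\widetilde X$. A space is *$k$-separable* if it contains a dense $\sigma$-compact set, and *Čech-complete* if it is a $G_\delta$-set in its Stone–Čech compactification. A continuous map $f:X\to Y$ is *skeletal* if $\operatorname{Int}\overline{f(U)}\neq\varnothing$ for every nonempty open $U\subset X$. A continuous map $p:X\to Y$ has a *metrizable kernel* if there are a separable metrizable space $M$ and an embedding of $X$ in $Y\times M$ under which $p$ is the restriction of the projection $Y\times M\to Y$. A space $X$ is *skeletally* (resp., *openly*) *Dugundji* if there are a nonzero cardinal $\tau$, identified with its initial ordinal, and an inverse system $S=\{X_\alpha,p^\beta_\alpha,\ \alpha<\beta<\tau\}$, indexed by the ordinals below $\tau$, of spaces and continuous surjective skeletal (resp., open) bonding maps such that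 1. $X_0$ is separable metrizable, and $p^{\alpha+1}_\alpha$ has a metrizable kernel whenever $\alpha+1<\tau$; 2. for every limit ordinal $\gamma<\tau$ the canonical map $X_\gamma\to\varprojlim\{X_\alpha,p^\beta_\alpha,\ \alpha<\beta<\gamma\}$ is an embedding with dense image; 3. there is an embedding of $X$ in $\varprojlim S$ such that $p_\alpha(X)=X_\alpha$ for every $\alpha<\tau$, where $p_\alpha:\varprojlim S\to X_\alpha$ is the limit projection; 4. for every bounded continuous $f:\varprojlim S\to\mathbb R$ there are $\alpha<\tau$ and a continuous $g:X_\alpha\to\mathbb R$ with $f=g\circ p_\alpha$. **Theorem 1.1.** Let the space $X$ carry a (jointly) continuous transitive action of an $\omega$-narrow semitopological group $G$ such that $X$ has a $G$-compactification. Then: (1) if $X$ contains a dense Čech-complete $k$-separable subspace, then $X$ is skeletally Dugundji; (2) if $X$ is Čech-complete and $\sigma$-compact, then $X$ is openly Dugundji. -/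

import Mathlib

open Set Topology
open scoped Pointwise

universe u v w

/-- A group with a topology is *ω-narrow* if for every neighbourhood `U` of the neutral element
there is a countable set `A` with `U * A = A * U = G`. -/
def IsOmegaNarrow (G : Type v) [Group G] [TopologicalSpace G] : Prop :=
  ∀ U ∈ 𝓝 (1 : G), ∃ A : Set G, A.Countable ∧ U * A = univ ∧ A * U = univ

/-- A Tychonoff space is *Čech-complete* if it is a `G_δ`-subset of its Stone-Čech
compactification. -/
structure IsCechComplete (X : Type u) [TopologicalSpace X] : Prop where
  t35 : T35Space X
  isGδ : IsGδ (range (stoneCechUnit : X → StoneCech X))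

/-- A space is *k-separable* if it contains a dense σ-compact set. -/
def IsKSeparable (X : Type u) [TopologicalSpace X] : Prop :=
  ∃ Z : Set X, Dense Z ∧ IsSigmaCompact Z

/-- `X` has a *`G`-compactification*: the action of `G` on `X` extends to a (jointly) continuous
action of `G` on some compactification `Y` of `X`. -/
def HasGCompactification (G : Type v) (X : Type u) [Group G] [TopologicalSpace G]
    [TopologicalSpace X] [MulAction G X] : Prop :=
  ∃ (Y : Type w) (_ : TopologicalSpace Y) (_ : MulAction G Y) (i : X → Y),
    CompactSpace Y ∧ T2Space Y ∧ ContinuousSMul G Y ∧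
      IsEmbedding i ∧ DenseRange i ∧ ∀ (g : G) (x : X), i (g • x) = g • i x

/-- A continuous map is *skeletal* if the closure of the image of every nonempty open set
has nonempty interior. -/
def IsSkeletal {X Y : Type u} [TopologicalSpace X] [TopologicalSpace Y] (f : X → Y) : Prop :=
  Continuous f ∧ ∀ U : Set X, IsOpen U → U.Nonempty → (interior (closure (f '' U))).Nonempty

/-- The map `p : X → Y` has a *metrizable kernel*: `X` embeds in `Y × M` for some separable
metrizable space `M`, in such a way that `p` becomes the restriction of the projection. -/
def HasMetrizableKernel {X Y : Type u} [TopologicalSpace X] [TopologicalSpace Y]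
    (p : X → Y) : Prop :=
  ∃ (M : Type u) (_ : TopologicalSpace M) (e : X → Y × M),
    TopologicalSpace.MetrizableSpace M ∧ TopologicalSpace.SeparableSpace M ∧
      IsEmbedding e ∧ ∀ x, (e x).1 = p x

/-- An inverse system of topological spaces and continuous maps over a preorder. -/
structure TopInverseSystem (I : Type v) [Preorder I] where
  /-- the spaces of the system -/
  obj : I → Type u
  /-- their topologies -/
  top : ∀ i, TopologicalSpace (obj i)
  /-- the bonding maps -/
  map : ∀ {i j : I}, i ≤ j → obj j → obj i
  continuous_map : ∀ {i j : I} (h : i ≤ j), Continuous (map h)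
  map_id : ∀ (i : I) (x : obj i), map (le_refl i) x = x
  map_comp : ∀ {i j k : I} (hij : i ≤ j) (hjk : j ≤ k) (x : obj k),
    map hij (map hjk x) = map (hij.trans hjk) x

namespace TopInverseSystem

variable {I : Type v} [Preorder I]

instance (S : TopInverseSystem.{u} I) (i : I) : TopologicalSpace (S.obj i) := S.top i

/-- The limit of an inverse system: the subspace of the product that consists of all threads. -/
def limit (S : TopInverseSystem.{u} I) : Type (max u v) :=
  {x : ∀ i, S.obj i // ∀ {i j : I} (h : i ≤ j), S.map h (x j) = x i}

instance (S : TopInverseSystem.{u} I) : TopologicalSpace S.limit :=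
  inferInstanceAs (TopologicalSpace
    {x : ∀ i, S.obj i // ∀ {i j : I} (h : i ≤ j), S.map h (x j) = x i})

/-- The limit projections. -/
def proj (S : TopInverseSystem.{u} I) (i : I) (x : S.limit) : S.obj i := x.1 i

/-- The restriction of an inverse system to a set of indices. -/
def restrict (S : TopInverseSystem.{u} I) (J : Set I) : TopInverseSystem.{u} J where
  obj i := S.obj i
  top i := S.top i
  map h := S.map h
  continuous_map h := S.continuous_map h
  map_id i := S.map_id i
  map_comp hij hjk := S.map_comp hij hjk

/-- The canonical map from `S.obj γ` to the limit of the part of the system strictly below `γ`. -/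
def toLimitBelow (S : TopInverseSystem.{u} I) (γ : I) (x : S.obj γ) :
    (S.restrict (Iio γ)).limit :=
  ⟨fun i => S.map (le_of_lt i.2) x, fun h => S.map_comp h _ x⟩

/-- The conditions, common to skeletally and openly Dugundji spaces, on a system `S` of spaces
(thought of as indexed by the ordinals below a cardinal) that represents `X`. -/
structure IsDugundjiSystem (S : TopInverseSystem.{u} I) (X : Type u) [TopologicalSpace X] :
    Prop where
  t35 : ∀ i, T35Space (S.obj i)
  surjective_map : ∀ {i j : I} (h : i ≤ j), Function.Surjective (S.map h)
  /-- the first space is separable and metrizable -/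
  first : ∀ i, IsMin i →
    TopologicalSpace.MetrizableSpace (S.obj i) ∧ TopologicalSpace.SeparableSpace (S.obj i)
  /-- bonding maps between consecutive spaces have metrizable kernels -/
  succ : ∀ {i j : I} (h : i ⋖ j), HasMetrizableKernel (S.map h.le)
  /-- almost continuity: at limit indices the space is a dense subspace of the limit of the
  preceding spaces -/
  almost_continuous : ∀ γ, Order.IsSuccLimit γ →
    IsEmbedding (S.toLimitBelow γ) ∧ DenseRange (S.toLimitBelow γ)
  /-- `X` is the almost limit of the system -/
  almost_limit : ∃ e : X → S.limit, IsEmbedding e ∧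
    ∀ i, Function.Surjective fun x => S.proj i (e x)
  /-- the system is factorizing -/
  factorizing : ∀ f : BoundedContinuousFunction S.limit ℝ,
    ∃ (i : I) (g : S.obj i → ℝ), Continuous g ∧ ∀ x, f x = g (S.proj i x)

end TopInverseSystem

/-- *Skeletally Dugundji* spaces. -/
def IsSkeletallyDugundji (X : Type u) [TopologicalSpace X] : Prop :=
  ∃ (τ : Cardinal.{u}) (S : TopInverseSystem.{u} (Iio τ.ord)), 0 < τ ∧
    (∀ {α β : Iio τ.ord} (h : α ≤ β), IsSkeletal (S.map h)) ∧ S.IsDugundjiSystem X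

/-- *Openly Dugundji* spaces. -/
def IsOpenlyDugundji (X : Type u) [TopologicalSpace X] : Prop :=
  ∃ (τ : Cardinal.{u}) (S : TopInverseSystem.{u} (Iio τ.ord)), 0 < τ ∧
    (∀ {α β : Iio τ.ord} (h : α ≤ β), IsOpenMap (S.map h)) ∧ S.IsDugundjiSystem X

/-!
Let `Y` be a `G`-compactification of `X`. For a family `B` of functions on `X` that extend
continuously over `Y`, let `X_B` be the image of `X` in `ℝ^B`. The spaces of the system are of this
form, and the bonding maps are the restrictions of coordinates.

Compactness of `Y` makes the action on each extendable function uniformly continuous at `1`, so by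
ω-narrowness the orbit of the function has a countable uniformly dense subset
(`exists_countable_dense_orbit`). Enlarging `B` by such countable sets, one function at a time along
a well-ordering, keeps the action on `X_B` (`JointImage.exists_homeomorph`), gives bonding maps with
metrizable kernels, and is continuous at limit ordinals by construction.

The topological content is that `X → X_B` is skeletal or open. For every neighbourhood `V` of `1`
countably many translates of `V • x` cover `X`, by ω-narrowness and transitivity. If `X_B` is not
meagre in itself, then the image of `V • x` is not meagre (`not_isMeagre_image_of_smul_mem`). This
gives skeletality at once (`isSkeletal_of_equivariant`), and openness for σ-compact `X` by a Baire
category argument as in the open mapping theorem (`isOpenMap_of_equivariant`). That `X_B` is not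
meagre holds as soon as `B` contains a suitable countable family, which comes from writing a dense
Čech-complete subspace as a `G_δ` of `Y` and separating the compact sets of a dense σ-compact
subset from the complements of the open sets involved (`exists_countable_not_isMeagre`). Properties
of the maps `X → X_B` pass to the bonding maps (`JointImage.isSkeletal_map`,
`JointImage.isOpenMap_map`).

The system is indexed by a successor cardinal `τ` exceeding the number of extendable functions, so
that all of them have been added at some stage `δ < τ`. Then `X`, `X_δ` and the limit are
homeomorphic, and the functions on the limit factor through `X_δ`. The stages beyond `δ` matter: if
`τ` had countable cofinality and new functions were added cofinally, a function depending on
countably many coordinates need not factor through any stage.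
-/

/-! ### Equivariant images of a homogeneous space -/

section Equivariant

variable {G : Type v} {X : Type u} [Group G] [TopologicalSpace G]
  [MulAction G X] {Z : Type u} [TopologicalSpace Z] {q : X → Z}

/-- Countably many translates of an orbit piece `V • x` cover `X`, so their images cover `Z`;
they are homeomorphic to each other, hence none of them is meagre. -/
theorem not_isMeagre_image_of_smul_mem [MulAction.IsPretransitive G X] (hG : IsOmegaNarrow G)
    (hqs : Function.Surjective q) (hq : ∀ g : G, ∃ h : Z ≃ₜ Z, ∀ x, h (q x) = q (g • x))
    (hZ : ¬ IsMeagre (univ : Set Z)) {V : Set G} (hV : V ∈ 𝓝 1) {x : X} {S : Set X}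
    (hS : ∀ v ∈ V, v • x ∈ S) : ¬ IsMeagre (q '' S) := by
  intro hm
  obtain ⟨A, hA, -, hAV⟩ := hG V hV
  choose h hh using hq
  refine hZ ((isMeagre_biUnion hA fun a _ => (h a).isInducing.isMeagre_image hm).mono ?_)
  intro z _
  obtain ⟨y, rfl⟩ := hqs z
  obtain ⟨g, rfl⟩ := MulAction.exists_smul_eq G x y
  obtain ⟨a, ha, v, hv, rfl⟩ : g ∈ A * V := hAV ▸ mem_univ g
  refine mem_iUnion₂.2 ⟨a, ha, q (v • x), mem_image_of_mem q (hS v hv), ?_⟩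
  rw [hh, mul_smul]

theorem isSkeletal_of_equivariant [TopologicalSpace X] [MulAction.IsPretransitive G X]
    [ContinuousSMul G X]
    (hG : IsOmegaNarrow G) (hqc : Continuous q)
    (hqs : Function.Surjective q) (hq : ∀ g : G, ∃ h : Z ≃ₜ Z, ∀ x, h (q x) = q (g • x))
    (hZ : Nonempty X → ¬ IsMeagre (univ : Set Z)) : IsSkeletal q := by
  refine ⟨hqc, fun U hU ⟨x, hx⟩ => ?_⟩
  have hV : {g : G | g • x ∈ U} ∈ 𝓝 1 := by
    have hc : ContinuousAt (fun g : G => g • x) 1 := by fun_prop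
    exact hc (by simpa using hU.mem_nhds hx)
  have := not_isMeagre_image_of_smul_mem hG hqs hq (hZ ⟨x⟩) hV (S := U) fun v hv => hv
  rw [nonempty_iff_ne_empty]
  exact fun h => this (IsNowhereDense.isMeagre h)

/-- The open mapping principle. The closure `C` of `V • x` is σ-compact and its image is not
meagre, so the image has an interior point, which may be taken of the form `q (v • x)` with
`v ∈ V`; translating back by `v⁻¹` gives a neighbourhood of `q x`. -/
theorem isOpenMap_of_equivariant [TopologicalSpace X] [MulAction.IsPretransitive G X]
    [SigmaCompactSpace X] [T2Space Z]
    (hG : IsOmegaNarrow G) (hqc : Continuous q)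
    (hqs : Function.Surjective q) (hq : ∀ g : G, ∃ h : Z ≃ₜ Z, ∀ x, h (q x) = q (g • x))
    (hZ : Nonempty X → ¬ IsMeagre (univ : Set Z))
    (hsmall : ∀ (x : X), ∀ U ∈ 𝓝 x, ∃ V ∈ 𝓝 (1 : G), ∀ v ∈ V,
      ∀ y ∈ closure ((fun g : G => g • x) '' V), v⁻¹ • y ∈ U) : IsOpenMap q := by
  rw [isOpenMap_iff_nhds_le]
  intro x W hW
  obtain ⟨V, hV, hVU⟩ := hsmall x _ hW
  set C := closure ((fun g : G => g • x) '' V)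
  have hm : ¬ IsMeagre (q '' C) := not_isMeagre_image_of_smul_mem hG hqs hq (hZ ⟨x⟩) hV
    fun v hv => subset_closure (mem_image_of_mem _ hv)
  have hint : (interior (q '' C)).Nonempty := by
    by_contra hne
    have hcov : q '' C ⊆ ⋃ n, q '' (C ∩ compactCovering X n) := by
      rw [← image_iUnion, ← inter_iUnion, iUnion_compactCovering, inter_univ]
    refine hm ((isMeagre_iUnion fun n => IsNowhereDense.isMeagre ?_).mono hcov)
    have hK : IsCompact (q '' (C ∩ compactCovering X n)) :=
      ((isCompact_compactCovering X n).inter_left isClosed_closure).image hqc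
    rw [hK.isClosed.isNowhereDense_iff, ← subset_empty_iff,
      ← not_nonempty_iff_eq_empty.1 hne]
    exact interior_mono (image_mono inter_subset_left)
  obtain ⟨z, hz⟩ := hint
  obtain ⟨y, hyC, rfl⟩ := interior_subset hz
  obtain ⟨-, hv, v, hvV, rfl⟩ := mem_closure_iff.1 hyC _ (isOpen_interior.preimage hqc) hz
  obtain ⟨h, hh⟩ := hq v⁻¹
  have hx : h (q (v • x)) = q x := by rw [hh, inv_smul_smul]
  rw [← hx, ← h.map_nhds_eq, Filter.mem_map]
  refine Filter.mem_of_superset (mem_interior_iff_mem_nhds.1 hv) ?_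
  rintro - ⟨y, hy, rfl⟩
  rw [mem_preimage, hh]
  exact hVU v hvV y hy

end Equivariant

/-! ### Continuous functions on a compact `G`-space -/

section Orbits

variable {G : Type v} [Group G] [TopologicalSpace G]

theorem eventually_abs_smul_sub_lt {Y : Type w} [TopologicalSpace Y] [CompactSpace Y]
    [MulAction G Y] [ContinuousSMul G Y] (f : C(Y, ℝ)) {ε : ℝ} (hε : 0 < ε) :
    {g : G | ∀ y, |f (g • y) - f y| < ε} ∈ 𝓝 1 := by
  let F : C(G × Y, ℝ) := ⟨fun p => f (p.1 • p.2), by fun_prop⟩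
  have hF : ContinuousAt F.curry 1 := F.curry.continuous.continuousAt
  filter_upwards [Metric.continuousAt_iff'.1 hF ε hε] with g hg y
  have := (ContinuousMap.dist_apply_le_dist (f := F.curry g) (g := F.curry 1) y).trans_lt hg
  simpa [F, Real.dist_eq] using this

/-- The orbit of a function that varies little along neighbourhoods of `1` has a countable
uniformly dense subset. -/
theorem exists_countable_dense_orbit {X : Type u} [MulAction G X] (hG : IsOmegaNarrow G)
    {f : X → ℝ} (hf : ∀ ε > 0, {g : G | ∀ x, |f (g • x) - f x| < ε} ∈ 𝓝 1) :
    ∃ A : Set (X → ℝ), A.Countable ∧ f ∈ A ∧ (∀ a ∈ A, ∃ g : G, ∀ x, a x = f (g • x)) ∧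
      ∀ (g : G), ∀ ε > 0, ∃ a ∈ A, ∀ x, |f (g • x) - a x| < ε := by
  choose S hSc hS _ using fun n : ℕ => hG _ (hf (1 / (n + 1)) Nat.one_div_pos_of_nat)
  refine ⟨(fun (g : G) x => f (g • x)) '' insert 1 (⋃ n, S n),
    ((countable_iUnion hSc).insert 1).image _, ⟨1, mem_insert _ _, by simp⟩, ?_, ?_⟩
  · rintro - ⟨g, -, rfl⟩
    exact ⟨g, fun _ => rfl⟩
  · intro g ε hε
    obtain ⟨n, hn⟩ := exists_nat_one_div_lt hε
    obtain ⟨b, hb, a, ha, rfl⟩ : g ∈ _ * S n := hS n ▸ mem_univ g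
    refine ⟨_, mem_image_of_mem _ (mem_insert_of_mem _ (mem_iUnion.2 ⟨n, ha⟩)), fun x => ?_⟩
    simp only [mul_smul]
    exact (hb (a • x)).trans hn

end Orbits

/-! ### Čech-complete subspaces of compact spaces -/

/-- A dense Čech-complete subspace of a compact Hausdorff space is a `G_δ`: the extension of the
inclusion to the Stone-Čech compactification maps the remainder onto the remainder. -/
theorem IsCechComplete.isGδ_range {D : Type u} {Y : Type w} [TopologicalSpace D]
    [TopologicalSpace Y] [CompactSpace Y] [T2Space Y] (hD : IsCechComplete D) {j : D → Y}
    (hj : IsEmbedding j) (hjd : DenseRange j) : IsGδ (range j) := by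
  have hF : Continuous (stoneCechExtend hj.continuous) := continuous_stoneCechExtend _
  have hFu := stoneCechExtend_stoneCechUnit hj.continuous
  set F := stoneCechExtend hj.continuous
  have hFs : Function.Surjective F := by
    rw [← range_eq_univ, ← hF.isClosedMap.isClosed_range.closure_eq]
    refine (hjd.mono ?_).closure_eq
    rintro - ⟨d, rfl⟩
    exact ⟨_, hFu d⟩
  have hrem : ∀ p, F p ∈ range j → p ∈ range (stoneCechUnit : D → StoneCech D) := by
    rintro p ⟨d, hd⟩
    by_contra hp
    have hne : p ≠ stoneCechUnit d := fun h => hp ⟨d, h.symm⟩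
    obtain ⟨W, W', hW, hW', hpW, hdW', hdisj⟩ := t2_separation hne
    obtain ⟨O, hO, hOW⟩ := hj.isInducing.isOpen_iff.1 (hW'.preimage continuous_stoneCechUnit)
    have hdO : j d ∈ O := by
      have : d ∈ j ⁻¹' O := hOW ▸ hdW'
      exact this
    obtain ⟨d', hd'⟩ := denseRange_stoneCechUnit.exists_mem_open (hW.inter (hO.preimage hF))
      ⟨p, hpW, by rw [mem_preimage, ← hd]; exact hdO⟩
    have h1 : d' ∈ j ⁻¹' O := by
      have := hd'.2
      rwa [mem_preimage, hFu] at this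
    rw [hOW] at h1
    exact hdisj.le_bot ⟨hd'.1, h1⟩
  obtain ⟨O, hO, hOD⟩ := isGδ_iff_eq_iInter_nat.1 hD.isGδ
  have : range j = ⋂ n, (F '' (O n)ᶜ)ᶜ := by
    ext y
    simp only [mem_iInter, mem_compl_iff, mem_image, not_exists, not_and]
    constructor
    · rintro ⟨d, rfl⟩ n p hp hpd
      have := hrem p (hpd ▸ mem_range_self d)
      rw [hOD] at this
      exact hp (mem_iInter.1 this n)
    · intro h
      obtain ⟨p, rfl⟩ := hFs y
      have : p ∈ ⋂ n, O n := mem_iInter.2 fun n => by_contra fun hp => h n p hp rfl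
      rw [← hOD] at this
      obtain ⟨d, rfl⟩ := this
      exact ⟨d, (hFu d).symm⟩
  rw [this]
  exact IsGδ.iInter_of_isOpen fun n => (hF.isClosedMap _ (hO n).isClosed_compl).isOpen_compl

/-! ### Joint images of families of functions -/

/-- The image of `X` in `ℝ^B` under the diagonal map of a family `B` of real functions on `X`. -/
abbrev JointImage {X : Type u} (B : Set (X → ℝ)) : Type u :=
  range fun (x : X) (b : B) => (b : X → ℝ) x

namespace JointImage

variable {X : Type u}

/-- The diagonal map of the family `B`, as a map onto its image. -/
def mk (B : Set (X → ℝ)) (x : X) : JointImage B :=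
  ⟨fun b => (b : X → ℝ) x, mem_range_self x⟩

theorem continuous_coord {B : Set (X → ℝ)} (b : B) :
    Continuous fun z : JointImage B => z.1 b :=
  (continuous_apply b).comp continuous_subtype_val

theorem mk_surjective (B : Set (X → ℝ)) : Function.Surjective (mk B) := by
  rintro ⟨-, x, rfl⟩
  exact ⟨x, rfl⟩

theorem mk_eq_iff {B : Set (X → ℝ)} {x y : X} : mk B x = mk B y ↔ ∀ b ∈ B, b x = b y := by
  simp [mk, funext_iff]

/-- For `B ⊆ C`, the restriction of coordinates from `C` to `B`. -/
def map {B C : Set (X → ℝ)} (h : B ⊆ C) (z : JointImage C) : JointImage B :=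
  ⟨fun b => z.1 ⟨b, h b.2⟩, by
    obtain ⟨-, x, rfl⟩ := z
    exact ⟨x, rfl⟩⟩

theorem map_mk {B C : Set (X → ℝ)} (h : B ⊆ C) (x : X) : map h (mk C x) = mk B x := rfl

theorem map_surjective {B C : Set (X → ℝ)} (h : B ⊆ C) : Function.Surjective (map h) := fun z =>
  let ⟨x, hx⟩ := mk_surjective B z
  ⟨mk C x, hx⟩

theorem continuous_map {B C : Set (X → ℝ)} (h : B ⊆ C) : Continuous (map h) :=
  Continuous.subtype_mk (continuous_pi fun b : B => continuous_coord ⟨b, h b.2⟩) _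

theorem continuous_mk [TopologicalSpace X] {B : Set (X → ℝ)} (hB : ∀ b ∈ B, Continuous b) :
    Continuous (mk B) :=
  Continuous.subtype_mk (continuous_pi fun b : B => hB b b.2) _

/-- If each translate of a member of `B` is a uniform limit of members of `B`, then the action
descends to the joint image. -/
theorem exists_homeomorph {G : Type v} [Group G] [MulAction G X] {B : Set (X → ℝ)}
    (hB : ∀ b ∈ B, ∀ (g : G), ∀ ε > 0, ∃ b' ∈ B, ∀ x, |b (g • x) - b' x| < ε) (g : G) :
    ∃ h : JointImage B ≃ₜ JointImage B, ∀ x, h (mk B x) = mk B (g • x) := by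
  let s := Function.surjInv (mk_surjective B)
  have hs : ∀ z, mk B (s z) = z := Function.surjInv_eq (mk_surjective B)
  let T : G → JointImage B → JointImage B := fun g z => mk B (g • s z)
  have hT : ∀ g x, T g (mk B x) = mk B (g • x) := by
    intro g x
    refine mk_eq_iff.2 fun b hb => ?_
    by_contra hne
    obtain ⟨b', hb', h⟩ := hB b hb g _ (half_pos (abs_pos.2 (sub_ne_zero.2 hne)))
    have h1 := h x
    have h2 := h (s (mk B x))
    rw [mk_eq_iff.1 (hs (mk B x)) b' hb'] at h2
    have h3 := abs_sub_le (b (g • s (mk B x))) (b' x) (b (g • x))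
    rw [abs_sub_comm (b' x)] at h3
    linarith
  have hTc : ∀ g, Continuous (T g) := by
    intro g
    refine Continuous.subtype_mk (continuous_pi fun b => ?_) _
    refine continuous_of_uniform_approx_of_continuous fun u hu => ?_
    obtain ⟨ε, hε, hεu⟩ := Metric.mem_uniformity_dist.1 hu
    obtain ⟨b', hb', h⟩ := hB b b.2 g ε hε
    refine ⟨fun z => z.1 ⟨b', hb'⟩, continuous_coord _, fun z => hεu ?_⟩
    have : z.1 ⟨b', hb'⟩ = b' (s z) := by
      conv_lhs => rw [← hs z]
      rfl
    change dist (b.1 (g • s z)) (z.1 ⟨b', hb'⟩) < ε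
    rw [this, Real.dist_eq]
    exact h (s z)
  have hinv : ∀ g g' : G, g * g' = 1 → ∀ z, T g (T g' z) = z := by
    intro g g' hg z
    obtain ⟨x, rfl⟩ := mk_surjective B z
    rw [hT g' x, hT g, smul_smul, hg, one_smul]
  exact ⟨⟨⟨T g, T g⁻¹, hinv _ _ (inv_mul_cancel g), hinv _ _ (mul_inv_cancel g)⟩, hTc g, hTc g⁻¹⟩,
    hT g⟩

theorem hasMetrizableKernel_map {B C : Set (X → ℝ)} (h : B ⊆ C) (hc : (C \ B).Countable) :
    HasMetrizableKernel (map h) := by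
  classical
  have : Countable (C \ B : Set (X → ℝ)) := hc
  refine ⟨(C \ B : Set (X → ℝ)) → ℝ, inferInstance,
    fun z => (map h z, fun b => z.1 ⟨b, b.2.1⟩),
    TopologicalSpace.metrizableSpace_of_t3_secondCountable _, inferInstance, ?_, fun _ => rfl⟩
  let k : JointImage B × ((C \ B : Set (X → ℝ)) → ℝ) → C → ℝ := fun p c =>
    if hcB : (c : X → ℝ) ∈ B then p.1.1 ⟨c, hcB⟩ else p.2 ⟨c, c.2, hcB⟩
  have hk : Continuous k := by
    refine continuous_pi fun c => ?_
    by_cases hcB : (c : X → ℝ) ∈ B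
    · simp only [k, dif_pos hcB]
      exact (continuous_coord _).comp continuous_fst
    · simp only [k, dif_neg hcB]
      fun_prop
  refine IsEmbedding.of_comp
    ((continuous_map h).prodMk (continuous_pi fun b => continuous_coord _)) hk ?_
  convert IsEmbedding.subtypeVal (p := fun z => z ∈ range fun (x : X) (b : C) => (b : X → ℝ) x)
    using 1
  funext z
  funext c
  by_cases hcB : (c : X → ℝ) ∈ B
  · simp [k, hcB, map]
  · simp [k, hcB]

theorem metrizableSpace_and_separableSpace {B : Set (X → ℝ)} (hB : B.Countable) :
    TopologicalSpace.MetrizableSpace (JointImage B) ∧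
      TopologicalSpace.SeparableSpace (JointImage B) := by
  have : Countable B := hB
  exact ⟨TopologicalSpace.metrizableSpace_of_t3_secondCountable _, inferInstance⟩

end JointImage

/-! ### Inverse systems of joint images -/

section System

variable {X : Type u} {I : Type v}

/-- The inverse system of the joint images of an increasing chain of families of functions. -/
def jointImageSystem [Preorder I] (B : I → Set (X → ℝ)) (hB : Monotone B) :
    TopInverseSystem.{u} I where
  obj i := JointImage (B i)
  top _ := inferInstance
  map h := JointImage.map (hB h)
  continuous_map h := JointImage.continuous_map (hB h)
  map_id _ _ := rfl
  map_comp _ _ _ := rfl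

/-- The bonding maps inherit properties of this kind from the maps `X → X_i`, because an open
subset of `X_j` has the same image in `X_i` as its open preimage in `X`. -/
theorem JointImage.isSkeletal_map [TopologicalSpace X] {B C : Set (X → ℝ)} (h : B ⊆ C)
    (hC : Continuous (mk C)) (hB : IsSkeletal (mk B)) : IsSkeletal (map h) := by
  refine ⟨continuous_map h, fun U hU hne => ?_⟩
  have := hB.2 _ (hU.preimage hC) (hne.preimage (mk_surjective C))
  rwa [show mk B = map h ∘ mk C from rfl, image_comp,
    image_preimage_eq U (mk_surjective C)] at this

theorem JointImage.isOpenMap_map [TopologicalSpace X] {B C : Set (X → ℝ)} (h : B ⊆ C)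
    (hC : Continuous (mk C)) (hB : IsOpenMap (mk B)) : IsOpenMap (map h) := by
  intro U hU
  have := hB _ (hU.preimage hC)
  rwa [show mk B = map h ∘ mk C from rfl, image_comp,
    image_preimage_eq U (mk_surjective C)] at this

/-- If `γ` is not minimal, the threads over the indices below `γ` are approximated by the points
of `X_γ`: a point that agrees with the thread at `i` agrees with it at all indices below `i`. -/
theorem TopInverseSystem.denseRange_toLimitBelow [LinearOrder I] (S : TopInverseSystem.{u} I)
    (hS : ∀ {i j : I} (h : i ≤ j), Function.Surjective (S.map h)) {γ : I} (hγ : ¬ IsMin γ) :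
    DenseRange (S.toLimitBelow γ) := by
  intro z
  obtain ⟨i₀, hi₀⟩ := not_isMin_iff.1 hγ
  have : Nonempty (Iio γ) := ⟨⟨i₀, hi₀⟩⟩
  choose y hy using fun i : Iio γ => hS (le_of_lt i.2) (z.1 i)
  refine mem_closure_of_tendsto (f := fun i => S.toLimitBelow γ (y i)) (b := Filter.atTop) ?_
    (Filter.Eventually.of_forall fun i => mem_range_self _)
  refine tendsto_subtype_rng.2 (tendsto_pi_nhds.2 fun k => ?_)
  refine tendsto_nhds_of_eventually_eq ?_
  filter_upwards [Filter.eventually_ge_atTop k] with i hi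
  change S.map (le_of_lt k.2) (y i) = z.1 k
  rw [← z.2 hi, ← hy i]
  exact (S.map_comp _ _ _).symm

theorem isEmbedding_toLimitBelow [Preorder I] (B : I → Set (X → ℝ)) (hB : Monotone B) {γ : I}
    (hγ : ∀ b ∈ B γ, ∃ i < γ, b ∈ B i) :
    IsEmbedding ((jointImageSystem B hB).toLimitBelow γ) := by
  choose i hi hbi using hγ
  let k : ((jointImageSystem B hB).restrict (Iio γ)).limit → B γ → ℝ := fun z b =>
    (show JointImage (B (i b b.2)) from z.1 ⟨i b b.2, hi b b.2⟩).1 ⟨b, hbi b b.2⟩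
  have hk : Continuous k := by
    refine continuous_pi fun b => ?_
    have h1 : Continuous fun z : ((jointImageSystem B hB).restrict (Iio γ)).limit =>
        z.1 ⟨i b b.2, hi b b.2⟩ := (continuous_apply _).comp continuous_subtype_val
    exact (continuous_apply _).comp (continuous_subtype_val.comp h1)
  have hc : Continuous ((jointImageSystem B hB).toLimitBelow γ) :=
    Continuous.subtype_mk (continuous_pi fun j => JointImage.continuous_map (hB j.2.le)) _
  exact IsEmbedding.of_comp hc hk
    (IsEmbedding.subtypeVal (p := fun z => z ∈ range fun (x : X) (b : B γ) => (b : X → ℝ) x))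

/-- The thread of a point of `X`. -/
def toJointImageLimit [Preorder I] (B : I → Set (X → ℝ)) (hB : Monotone B) (x : X) :
    (jointImageSystem B hB).limit :=
  ⟨fun i => JointImage.mk (B i) x, fun h => JointImage.map_mk (hB h) x⟩

/-- A chain of families that adds countably many
functions at each step, is continuous at limits, and at some index `δ` induces the topology of `X`,
gives a Dugundji system for `X`. Since `X → X_δ` is a homeomorphism, so is `X → lim S`, and every
function on the limit factors through `X_δ`. -/
theorem isDugundjiSystem_jointImageSystem [TopologicalSpace X] [T0Space X] [LinearOrder I]
    (B : I → Set (X → ℝ)) (hB : Monotone B) (hcont : ∀ i, ∀ b ∈ B i, Continuous b)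
    (hfirst : ∀ i, IsMin i → (B i).Countable)
    (hsucc : ∀ i j, i ⋖ j → (B j \ B i).Countable)
    (hlim : ∀ γ, Order.IsSuccLimit γ → ∀ b ∈ B γ, ∃ i < γ, b ∈ B i)
    (δ : I) (hind : IsInducing (JointImage.mk (B δ))) :
    (jointImageSystem B hB).IsDugundjiSystem X := by
  have hqe : IsEmbedding (JointImage.mk (B δ)) := hind.isEmbedding
  have hec : Continuous (toJointImageLimit B hB) :=
    Continuous.subtype_mk (continuous_pi fun i => JointImage.continuous_mk (hcont i)) _
  have hpc : Continuous fun z => (jointImageSystem B hB).proj δ z :=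
    (continuous_apply _).comp continuous_subtype_val
  have hes : Function.Surjective (toJointImageLimit B hB) := by
    intro z
    obtain ⟨x, hx⟩ := JointImage.mk_surjective (B δ) (z.1 δ)
    refine ⟨x, Subtype.ext (funext fun i => ?_)⟩
    obtain ⟨y, hy⟩ := JointImage.mk_surjective (B i) (z.1 i)
    change JointImage.mk (B i) x = z.1 i
    rw [← hy]
    rcases le_total i δ with h | h
    · rw [hy, ← z.2 h, ← hx]
      rfl
    · have h1 : JointImage.mk (B δ) x = JointImage.mk (B δ) y := by
        rw [hx, ← z.2 h, ← hy]
        rfl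
      rw [hqe.injective h1]
  refine ⟨fun i => inferInstanceAs (T35Space (JointImage (B i))),
    fun h => JointImage.map_surjective (hB h),
    fun i hi => JointImage.metrizableSpace_and_separableSpace (hfirst i hi),
    fun h => JointImage.hasMetrizableKernel_map (hB h.le) (hsucc _ _ h),
    fun γ hγ => ⟨isEmbedding_toLimitBelow B hB (hlim γ hγ),
      TopInverseSystem.denseRange_toLimitBelow _ (fun h => JointImage.map_surjective (hB h))
        hγ.not_isMin⟩,
    ⟨toJointImageLimit B hB, hqe.of_comp hec hpc, fun i => JointImage.mk_surjective (B i)⟩, ?_⟩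
  intro f
  let e := hqe.toHomeomorphOfSurjective (JointImage.mk_surjective _)
  refine ⟨δ, fun z => f (toJointImageLimit B hB (e.symm z)),
    f.continuous.comp (hec.comp e.symm.continuous), fun z => ?_⟩
  obtain ⟨x, rfl⟩ := hes z
  change _ = f (toJointImageLimit B hB (e.symm (e x)))
  rw [e.symm_apply_apply]

end System

/-! ### Restrictions of functions from a compactification -/

section Compactification

/-- The functions on `X` that extend over `i : X → Y` to continuous functions on `Y`. -/
def extendableFunctions {X : Type u} {Y : Type w} [TopologicalSpace Y] (i : X → Y) :
    Set (X → ℝ) :=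
  {φ | ∃ f : C(Y, ℝ), ∀ x, φ x = f (i x)}

variable {X : Type u} [TopologicalSpace X] {Y : Type w} [TopologicalSpace Y] {i : X → Y}

theorem exists_extendableFunctions_abs_sub_lt [CompactSpace Y] [T2Space Y] (hi : IsInducing i)
    (x : X) {U : Set X} (hU : U ∈ 𝓝 x) :
    ∃ φ ∈ extendableFunctions i, ∀ y, |φ y - φ x| < 1 → y ∈ U := by
  rw [hi.nhds_eq_comap, Filter.mem_comap] at hU
  obtain ⟨W, hW, hWU⟩ := hU
  obtain ⟨O, hOW, hO, hxO⟩ := mem_nhds_iff.1 hW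
  obtain ⟨f, hf0, hf1, -⟩ := exists_continuous_zero_one_of_isClosed
    (isClosed_singleton (x := i x)) hO.isClosed_compl (by simpa using hxO)
  refine ⟨fun y => f (i y), ⟨f, fun _ => rfl⟩, fun y hy => hWU (hOW (by_contra fun hyO => ?_))⟩
  have h0 : f (i x) = 0 := hf0 rfl
  have h1 : f (i y) = 1 := hf1 hyO
  simp [h0, h1] at hy

theorem isInducing_mk_of_extendableFunctions_subset [CompactSpace Y] [T2Space Y]
    (hi : IsInducing i) {B : Set (X → ℝ)} (hB : extendableFunctions i ⊆ B)
    (hc : ∀ b ∈ B, Continuous b) : IsInducing (JointImage.mk B) := by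
  rw [isInducing_iff_nhds]
  refine fun x => le_antisymm (JointImage.continuous_mk hc).continuousAt.le_comap fun U hU => ?_
  obtain ⟨φ, hφ, hφU⟩ := exists_extendableFunctions_abs_sub_lt hi x hU
  refine Filter.mem_comap.2 ⟨{z | |z.1 ⟨φ, hB hφ⟩ - φ x| < 1}, ?_, fun y hy => hφU y hy⟩
  refine IsOpen.mem_nhds ?_ (by simp [JointImage.mk])
  exact isOpen_lt ((JointImage.continuous_coord _).sub continuous_const).abs continuous_const

/-- A dense Čech-complete k-separable subspace makes the joint images of all large enough families
of extendable functions non-meagre. Write `D = ⋂ O n` in `Y` and let `⋃ K m` be σ-compact and dense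
in `D`; if the family contains functions `f n m` that are `1` on `K m` and `0` off `O n`, then the
points with `∀ n, ∃ m, 0 < f n m` form a dense `G_δ` of the compact joint image of `Y`, and this
set lies in the joint image of `D`. -/
theorem exists_countable_not_isMeagre [CompactSpace Y] [T2Space Y] (hi : IsEmbedding i)
    (hid : DenseRange i) {D : Type u} [TopologicalSpace D] {j : D → X} (hj : IsEmbedding j)
    (hjd : DenseRange j) (hD : IsCechComplete D) (hk : IsKSeparable D) :
    ∃ B₀ ⊆ extendableFunctions i, B₀.Countable ∧ ∀ B, B₀ ⊆ B → B ⊆ extendableFunctions i →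
      Nonempty X → ¬ IsMeagre (univ : Set (JointImage B)) := by
  obtain ⟨Z, hZ, K, hK, rfl⟩ := hk
  have hijd : DenseRange (i ∘ j) := hid.comp hjd hi.continuous
  obtain ⟨O, hO, hOD⟩ := isGδ_iff_eq_iInter_nat.1 (hD.isGδ_range (hi.comp hj) hijd)
  have hfex : ∀ n m, ∃ f : C(Y, ℝ), EqOn f 0 (O n)ᶜ ∧ EqOn f 1 ((i ∘ j) '' K m) := by
    intro n m
    have hdisj : Disjoint (O n)ᶜ ((i ∘ j) '' K m) := by
      rw [disjoint_compl_left_iff_subset]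
      refine (image_subset_range _ _).trans ?_
      rw [hOD]
      exact iInter_subset _ n
    obtain ⟨f, h0, h1, -⟩ := exists_continuous_zero_one_of_isClosed (hO n).isClosed_compl
      ((hK m).image (hi.comp hj).continuous).isClosed hdisj
    exact ⟨f, h0, h1⟩
  choose f hf0 hf1 using hfex
  refine ⟨range fun p : ℕ × ℕ => fun x => f p.1 p.2 (i x), ?_, countable_range _, ?_⟩
  · rintro - ⟨p, rfl⟩
    exact ⟨f p.1 p.2, fun _ => rfl⟩
  intro B hB₀ hB hne hm
  choose F hF using fun b : B => hB b.2
  let E : Y → B → ℝ := fun y b => F b y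
  have hE : Continuous E := by fun_prop
  have hEi : ∀ x (b : B), E (i x) b = (b : X → ℝ) x := fun x b => (hF b x).symm
  have : CompactSpace (range E) := isCompact_iff_compactSpace.1 (isCompact_range hE)
  have : Nonempty (range E) := ⟨⟨E (i hne.some), mem_range_self _⟩⟩
  let k : JointImage B → range E := fun z => ⟨z.1, by
    obtain ⟨-, x, rfl⟩ := z
    exact ⟨i x, funext (hEi x)⟩⟩
  have hkind : IsInducing k :=
    IsInducing.of_comp (Continuous.subtype_mk continuous_subtype_val _) continuous_subtype_val
      IsInducing.subtypeVal
  let c : ℕ → ℕ → B := fun n m => ⟨fun x => f n m (i x), hB₀ ⟨(n, m), rfl⟩⟩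
  -- The chosen extension of a function on `X` is unique, as `X` is dense in `Y`.
  have hc : ∀ n m y, E y (c n m) = f n m y := fun n m y =>
    congrFun (hid.equalizer (F (c n m)).continuous (f n m).continuous
      (funext fun x => (hF (c n m) x).symm)) y
  let W : Set (range E) := ⋂ n, ⋃ m, {z | 0 < z.1 (c n m)}
  have hWG : IsGδ W := IsGδ.iInter_of_isOpen fun n => isOpen_iUnion fun m =>
    isOpen_lt continuous_const ((continuous_apply _).comp continuous_subtype_val)
  let e : Y → range E := rangeFactorization E
  have hec : Continuous e := hE.subtype_mk _
  have hWd : Dense W := by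
    have h1 : Dense ((e ∘ (i ∘ j)) '' ⋃ m, K m) :=
      (DenseRange.comp rangeFactorization_surjective.denseRange hijd hec).dense_image
        (hec.comp (hi.comp hj).continuous) hZ
    refine h1.mono ?_
    rintro - ⟨d, hd, rfl⟩
    obtain ⟨m, hm⟩ := mem_iUnion.1 hd
    refine mem_iInter.2 fun n => mem_iUnion.2 ⟨m, ?_⟩
    change 0 < E (i (j d)) (c n m)
    have : f n m (i (j d)) = 1 := hf1 n m (mem_image_of_mem (i ∘ j) hm)
    rw [hc, this]
    exact one_pos
  have hWk : W ⊆ k '' univ := by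
    rintro ⟨-, y, rfl⟩ hy
    have hyD : y ∈ range (i ∘ j) := by
      rw [hOD]
      refine mem_iInter.2 fun n => ?_
      obtain ⟨m, hm⟩ := mem_iUnion.1 (mem_iInter.1 hy n)
      have hm' : 0 < E y (c n m) := hm
      rw [hc] at hm'
      by_contra hyO
      exact hm'.ne' (hf0 n m hyO)
    obtain ⟨d, rfl⟩ := hyD
    exact ⟨JointImage.mk B (j d), mem_univ _, Subtype.ext (funext fun b => (hEi (j d) b).symm)⟩
  exact not_isMeagre_of_isGδ_of_dense hWG hWd ((hkind.isMeagre_image hm).mono hWk)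

end Compactification

/-! ### The Dugundji system of a homogeneous space -/

/-- A Dugundji system of joint images for `X`, indexed by the ordinals below `τ`, such that the
maps `X → X_α` are equivariant with non-meagre targets. -/
theorem exists_equivariant_jointImageSystem {G : Type v} {X : Type u}
    [Group G] [TopologicalSpace G] [TopologicalSpace X] [T0Space X] [MulAction G X]
    (hG : IsOmegaNarrow G) {Y : Type w} [TopologicalSpace Y] [MulAction G Y] [CompactSpace Y]
    [T2Space Y] [ContinuousSMul G Y] {i : X → Y} (hi : IsEmbedding i) (hid : DenseRange i)
    (hig : ∀ (g : G) (x : X), i (g • x) = g • i x) {D : Type u} [TopologicalSpace D] {j : D → X}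
    (hj : IsEmbedding j) (hjd : DenseRange j) (hD : IsCechComplete D) (hk : IsKSeparable D) :
    ∃ (τ : Cardinal.{u}) (B : Iio τ.ord → Set (X → ℝ)) (hB : Monotone B), 0 < τ ∧
      (jointImageSystem B hB).IsDugundjiSystem X ∧ ∀ α, (∀ b ∈ B α, Continuous b) ∧
        (∀ g : G, ∃ h : JointImage (B α) ≃ₜ JointImage (B α),
          ∀ x, h (JointImage.mk (B α) x) = JointImage.mk (B α) (g • x)) ∧
        (Nonempty X → ¬ IsMeagre (univ : Set (JointImage (B α)))) := by
  obtain ⟨B₀, hB₀, hB₀c, hmeagre⟩ := exists_countable_not_isMeagre hi hid hj hjd hD hk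
  let Φ := extendableFunctions i
  have hcont : ∀ φ ∈ Φ, Continuous φ := by
    rintro φ ⟨f, hf⟩
    rw [funext hf]
    exact f.continuous.comp hi.continuous
  have horb : ∀ φ : Φ, ∃ A : Set (X → ℝ), A.Countable ∧ φ.1 ∈ A ∧
      (∀ a ∈ A, ∃ g : G, ∀ x, a x = φ.1 (g • x)) ∧
      ∀ (g : G), ∀ ε > 0, ∃ a ∈ A, ∀ x, |φ.1 (g • x) - a x| < ε := by
    rintro ⟨φ, f, hf⟩
    refine exists_countable_dense_orbit hG fun ε hε => ?_
    filter_upwards [eventually_abs_smul_sub_lt (G := G) f hε] with g hg x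
    rw [hf, hf, hig]
    exact hg (i x)
  choose A hAc hAmem hAorb hAdense using horb
  have hAΦ : ∀ φ, A φ ⊆ Φ := by
    rintro ⟨φ, f, hf⟩ a ha
    obtain ⟨g, hg⟩ := hAorb _ a ha
    refine ⟨f.comp ⟨fun y => g • y, by fun_prop⟩, fun x => ?_⟩
    rw [hg]
    change φ (g • x) = f (g • i x)
    rw [hf, hig]
  have hAinv : ∀ φ, ∀ b ∈ A φ, ∀ (g : G), ∀ ε > 0, ∃ b' ∈ A φ, ∀ x, |b (g • x) - b' x| < ε := by
    intro φ b hb g ε hε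
    obtain ⟨g', hg'⟩ := hAorb φ b hb
    obtain ⟨a, ha, h⟩ := hAdense φ (g' * g) ε hε
    refine ⟨a, ha, fun x => ?_⟩
    rw [hg', smul_smul]
    exact h x
  -- The translates of `φ` in `A φ` belong to `B α` for all `α > r φ`.
  let r : Φ → Ordinal.{u} := Ordinal.typein WellOrderingRel
  let δ : Ordinal.{u} := Ordinal.type (WellOrderingRel (α := Φ))
  let τ : Cardinal.{u} := Order.succ (Cardinal.mk Φ)
  have hδ : δ < τ.ord := by
    rw [Cardinal.lt_ord, Ordinal.card_type]
    exact Order.lt_succ _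
  have hrδ : ∀ φ, r φ < δ := fun φ => Ordinal.typein_lt_type _ φ
  have hr : Function.Injective r := Ordinal.typein_injective _
  let base : Set (X → ℝ) := ⋃ b : B₀, A ⟨b, hB₀ b.2⟩
  let B : Iio τ.ord → Set (X → ℝ) := fun α => base ∪ ⋃ φ, ⋃ _ : r φ < α.1, A φ
  have hbase : base.Countable := by
    have : Countable B₀ := hB₀c
    exact countable_iUnion fun b => hAc _
  have hmemB : ∀ {α : Iio τ.ord} {b}, b ∈ B α ↔ b ∈ base ∨ ∃ φ, r φ < α.1 ∧ b ∈ A φ := by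
    intro α b
    simp [B]
  have hB : Monotone B := fun α β h b hb => by
    rw [hmemB] at hb ⊢
    exact hb.imp_right fun ⟨φ, hφ, hbφ⟩ => ⟨φ, hφ.trans_le h, hbφ⟩
  have hBex : ∀ {α b}, b ∈ B α → ∃ φ, A φ ⊆ B α ∧ b ∈ A φ := by
    intro α b hb
    rcases hmemB.1 hb with hb | ⟨φ, hφ, hbφ⟩
    · obtain ⟨b₀, hb₀⟩ := mem_iUnion.1 hb
      exact ⟨_, fun a ha => Or.inl (mem_iUnion.2 ⟨b₀, ha⟩), hb₀⟩
    · exact ⟨φ, fun a ha => hmemB.2 (Or.inr ⟨φ, hφ, ha⟩), hbφ⟩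
  have hBΦ : ∀ α, B α ⊆ Φ := fun α b hb => by
    obtain ⟨φ, -, hbφ⟩ := hBex hb
    exact hAΦ φ hbφ
  refine ⟨τ, B, hB, pos_of_gt (Order.lt_succ _), ?_, fun α =>
    ⟨fun b hb => hcont b (hBΦ α hb), JointImage.exists_homeomorph ?_, hmeagre _ ?_ (hBΦ α)⟩⟩
  · refine isDugundjiSystem_jointImageSystem B hB (fun α b hb => hcont b (hBΦ α hb))
      ?_ ?_ ?_ ⟨δ, hδ⟩ (isInducing_mk_of_extendableFunctions_subset hi.isInducing ?_
        fun b hb => hcont b (hBΦ _ hb))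
    · intro α hα
      refine hbase.mono fun b hb => (hmemB.1 hb).resolve_right ?_
      rintro ⟨φ, hφ, -⟩
      exact hα.not_lt (b := ⟨r φ, hφ.trans α.2⟩) hφ
    · intro α β hαβ
      -- A function added between `α` and its successor is the one of stage `α`.
      have hstage : ∀ φ, r φ < β.1 → ¬ r φ < α.1 → r φ = α.1 := by
        intro φ hφβ hφα
        refine (not_lt.1 hφα).eq_of_not_lt' fun h => ?_
        exact hαβ.2 (c := ⟨r φ, hφβ.trans β.2⟩) h hφβ
      by_cases hex : ∃ φ, r φ = α.1
      · obtain ⟨φ, hφ⟩ := hex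
        refine (hAc φ).mono fun b hb => ?_
        rcases hmemB.1 hb.1 with hb' | ⟨ψ, hψ, hbψ⟩
        · exact absurd (hmemB.2 (Or.inl hb')) hb.2
        · have := hstage ψ hψ fun h => hb.2 (hmemB.2 (Or.inr ⟨ψ, h, hbψ⟩))
          rwa [hr (hφ.trans this.symm)]
      · refine (countable_empty).mono fun b hb => ?_
        rcases hmemB.1 hb.1 with hb' | ⟨ψ, hψ, hbψ⟩
        · exact absurd (hmemB.2 (Or.inl hb')) hb.2
        · exact hex ⟨ψ, hstage ψ hψ fun h => hb.2 (hmemB.2 (Or.inr ⟨ψ, h, hbψ⟩))⟩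
    · intro γ hγ b hb
      rcases hmemB.1 hb with hb' | ⟨φ, hφ, hbφ⟩
      · obtain ⟨α, hα⟩ := not_isMin_iff.1 hγ.not_isMin
        exact ⟨α, hα, hmemB.2 (Or.inl hb')⟩
      · let α : Iio τ.ord := ⟨r φ, hφ.trans γ.2⟩
        obtain ⟨β, hαβ, hβ⟩ := (not_covBy_iff (a := α) hφ).1 (hγ.isSuccPrelimit α)
        exact ⟨β, hβ, hmemB.2 (Or.inr ⟨φ, hαβ, hbφ⟩)⟩
    · exact fun φ hφ => hmemB.2 (Or.inr ⟨⟨φ, hφ⟩, hrδ _, hAmem _⟩)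
  · intro b hb g ε hε
    obtain ⟨φ, hφ, hbφ⟩ := hBex hb
    obtain ⟨b', hb', h⟩ := hAinv φ b hbφ g ε hε
    exact ⟨b', hφ hb', h⟩
  · exact fun b hb => Or.inl (mem_iUnion.2 ⟨⟨b, hb⟩, hAmem ⟨b, hB₀ hb⟩⟩)

/-- Small pieces of orbits are small in the sense that the open mapping principle needs: the
neighbourhoods of `1` given by a function on the compactification are symmetric, which makes up for
the inversion of a semitopological group not being continuous. -/
theorem exists_nhds_one_inv_smul_mem {G : Type v} {X : Type u}
    [Group G] [TopologicalSpace G] [TopologicalSpace X] [MulAction G X]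
    {Y : Type w} [TopologicalSpace Y] [MulAction G Y] [CompactSpace Y]
    [T2Space Y] [ContinuousSMul G Y] {i : X → Y} (hi : IsInducing i)
    (hig : ∀ (g : G) (x : X), i (g • x) = g • i x) (x : X) {U : Set X} (hU : U ∈ 𝓝 x) :
    ∃ V ∈ 𝓝 (1 : G), ∀ v ∈ V, ∀ y ∈ closure ((fun g : G => g • x) '' V), v⁻¹ • y ∈ U := by
  obtain ⟨φ, ⟨f, hf⟩, hφ⟩ := exists_extendableFunctions_abs_sub_lt hi x hU
  refine ⟨_, eventually_abs_smul_sub_lt f (show (0 : ℝ) < 1 / 2 by norm_num),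
    fun v hv y hy => hφ _ ?_⟩
  have hcl : closure ((fun g : G => g • x) '' {g : G | ∀ y, |f (g • y) - f y| < 1 / 2}) ⊆
      {y | |φ y - φ x| ≤ 1 / 2} := by
    refine closure_minimal ?_ (isClosed_le ?_ continuous_const)
    · rintro - ⟨g, hg, rfl⟩
      change |φ (g • x) - φ x| ≤ 1 / 2
      rw [hf, hf, hig]
      exact (hg (i x)).le
    · rw [funext hf]
      exact ((f.continuous.comp hi.continuous).sub continuous_const).abs
  have h1 : |φ y - φ x| ≤ 1 / 2 := hcl hy
  have h2 : |φ y - φ (v⁻¹ • y)| < 1 / 2 := by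
    have := hv (v⁻¹ • i y)
    rwa [smul_inv_smul, ← hig, ← hf, ← hf] at this
  rw [abs_sub_comm] at h2
  linarith [abs_sub_le (φ (v⁻¹ • y)) (φ y) (φ x)]

theorem theorem1p1 (G : Type v) (X : Type u)
    [Group G] [TopologicalSpace G] [SeparatelyContinuousMul G]
    [TopologicalSpace X] [T35Space X]
    [MulAction G X] [ContinuousSMul G X] [MulAction.IsPretransitive G X]
    (hG : IsOmegaNarrow G) (hX : HasGCompactification.{u, v, w} G X) :
    ((∃ D : Set X, Dense D ∧ IsCechComplete D ∧ IsKSeparable D) → IsSkeletallyDugundji X) ∧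
      (IsCechComplete X ∧ SigmaCompactSpace X → IsOpenlyDugundji X) := by
  obtain ⟨Y, _, _, i, _, _, _, hi, hid, hig⟩ := hX
  constructor
  · rintro ⟨D, hDd, hD, hDk⟩
    obtain ⟨τ, B, hB, hτ, hS, h⟩ := exists_equivariant_jointImageSystem hG hi hid hig
      IsEmbedding.subtypeVal hDd.denseRange_val hD hDk
    refine ⟨τ, jointImageSystem B hB, hτ, fun {α β} hαβ => ?_, hS⟩
    exact JointImage.isSkeletal_map (hB hαβ) (JointImage.continuous_mk (h β).1)
      (isSkeletal_of_equivariant hG (JointImage.continuous_mk (h α).1)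
        (JointImage.mk_surjective _) (h α).2.1 (h α).2.2)
  · rintro ⟨hD, _⟩
    obtain ⟨τ, B, hB, hτ, hS, h⟩ := exists_equivariant_jointImageSystem hG hi hid hig
      IsEmbedding.id denseRange_id hD ⟨univ, dense_univ, isSigmaCompact_univ⟩
    refine ⟨τ, jointImageSystem B hB, hτ, fun {α β} hαβ => ?_, hS⟩
    exact JointImage.isOpenMap_map (hB hαβ) (JointImage.continuous_mk (h β).1)
      (isOpenMap_of_equivariant hG (JointImage.continuous_mk (h α).1)
        (JointImage.mk_surjective _) (h α).2.1 (h α).2.2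
        fun x U hU => exists_nhds_one_inv_smul_mem hi.isInducing hig x hU)
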